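/- Let $k$ be an algebraically closed field of characteristic $0$, and let $(R,\mathfrak m)$ be a complete noetherian local domain of dimension $1$ containing $k$ with $R/\mathfrak m=k$. Let $\overline R$ be the normalization of $R$ (its integral closure in its field of fractions), which is isomorphic as a $k$-algebra to a formal power series ring $k[[t]]$, and let $v$ be the $t$-adic valuation. Let $\mathfrak C_R=\{r\in R : r\overline R\subseteq R\}$ be the conductor ideal. Let $n=\dim_k \mathfrak m/\mathfrak m^2$ be the embedding dimension of $R$. The Herzog--Kunz sequence of $R$ is the sequence $a_1<\dots<a_n$ with $\{a_1,\dots,a_n\}=v(\mathfrak m)\setminus v(\mathfrak m^2)$, and Herzog--Kunz generators of $R$ are elements $x_1,\dots,x_n\in R$ with $v(x_i)=a_i$ for all $i$. Let $d\colon R\to\widetilde\Omega^1_{R/k}$ be the universally finite module of differentials, i.e. $\widetilde\Omega^1_{R/k}$ is a finitely generated $R$-module, $d$ is a $k$-derivation, and every $k$-derivation of $R$ into a finitely generated $R$-module factors uniquely through $d$; it exists. Suppose that $\mathfrak C_R\not\subseteq\mathfrak m^2$. Then the local parameter $t$ of $\overline R=k[[t]]$ can be chosen such that $R$ has a Herzog--Kunz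 parametrization $R=k[[x_1,\dots,x_n]]$ by Herzog--Kunz generators with $x_1=t^{a_1}$ and $x_n=t^{a_n}$. If moreover $R$ is not regular, i.e. $n\ge 2$, then for every such choice $$\omega=a_n x_n\,dx_1-a_1x_1\,dx_n\in\widetilde\Omega^1_{R/k}$$ is a nonzero torsion element. -/

import Mathlib

open IsLocalRing

universe u v w

/-- The normalization of a domain `R`: its integral closure in its field of fractions. -/
abbrev Normalization (R : Type v) [CommRing R] [IsDomain R] : Subalgebra R (FractionRing R) :=
  integralClosure R (FractionRing R)

/-- The conductor ideal `{r ∈ R | r · R̄ ⊆ R}` of a domain `R` in its normalization `R̄`. -/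
def conductorIdeal (R : Type v) [CommRing R] [IsDomain R] : Ideal R where
  carrier := {r | ∀ y : Normalization R, ∃ s : R,
    algebraMap R (Normalization R) s = algebraMap R (Normalization R) r * y}
  zero_mem' := fun y => ⟨0, by simp⟩
  add_mem' := by
    intro a b ha hb y
    obtain ⟨s, hs⟩ := ha y
    obtain ⟨s', hs'⟩ := hb y
    exact ⟨s + s', by rw [map_add, map_add, hs, hs', add_mul]⟩
  smul_mem' := by
    intro c a ha y
    obtain ⟨s, hs⟩ := ha y
    exact ⟨c * s, by rw [smul_eq_mul, map_mul, map_mul, hs, mul_assoc]⟩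

section

variable {k : Type u} {R : Type v} [Field k] [CommRing R] [IsDomain R] [Algebra k R]

/-- The `t`-adic valuation on `R`, for an identification `R̄ = k[[t]]` of the normalization
of `R` with the formal power series ring (the value at `0` is `⊤`). The chosen local parameter
of `R̄` is the image of the power series variable. -/
noncomputable def tVal (t : PowerSeries k ≃ₐ[k] Normalization R) (r : R) : ℕ∞ :=
  (t.symm (algebraMap R (Normalization R) r)).order

/-- The set `v(I)` of the (finite) values of the elements of an ideal `I` of `R`. -/
def valueSet (t : PowerSeries k ≃ₐ[k] Normalization R) (I : Ideal R) : Set ℕ :=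
  {a | ∃ f ∈ I, tVal t f = a}

/-- `R = k[[x_1, …, x_n]]`: there is a surjective homomorphism of `k`-algebras from the formal
power series ring in `n` variables onto `R` which sends the `i`-th variable to `x_i`. -/
def IsPowerSeriesGenerated (k : Type u) {R : Type v} [Field k] [CommRing R] [Algebra k R]
    {n : ℕ} (x : Fin n → R) : Prop :=
  ∃ φ : MvPowerSeries (Fin n) k →ₐ[k] R,
    (∀ i, φ (MvPowerSeries.X i) = x i) ∧ Function.Surjective φ

/-- `a_1 < ⋯ < a_n` is the Herzog–Kunz sequence of `R`: it enumerates `v(𝔪) ∖ v(𝔪²)`, and `n` is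
the embedding dimension of `R`. -/
structure IsHerzogKunzSequence [IsLocalRing R] (t : PowerSeries k ≃ₐ[k] Normalization R)
    {n : ℕ} (a : Fin n → ℕ) : Prop where
  strictMono : StrictMono a
  edim : n = Module.finrank (ResidueField R) (CotangentSpace R)
  range_eq : Set.range a = valueSet t (maximalIdeal R) \ valueSet t (maximalIdeal R ^ 2)

/-- `x_1, …, x_{n+1}` is a Herzog–Kunz parametrization `R = k[[x_1, …, x_{n+1}]]`, with
Herzog–Kunz sequence `a_1 < ⋯ < a_{n+1}`, whose first and last members are the pure powers
`t ^ a_1` and `t ^ a_{n+1}` of the local parameter `t` of `R̄ = k[[t]]`. -/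
structure IsPureHerzogKunzParametrization [IsLocalRing R]
    (t : PowerSeries k ≃ₐ[k] Normalization R)
    {n : ℕ} (a : Fin (n + 1) → ℕ) (x : Fin (n + 1) → R) : Prop where
  isHerzogKunzSequence : IsHerzogKunzSequence t a
  val_eq : ∀ i, tVal t (x i) = a i
  generates : IsPowerSeriesGenerated k x
  first_eq : algebraMap R (Normalization R) (x 0) = t PowerSeries.X ^ a 0
  last_eq : algebraMap R (Normalization R) (x (Fin.last n)) = t PowerSeries.X ^ a (Fin.last n)

end

/-- `d : R → Ω` is a universally finite `k`-derivation, so that `Ω` is the universally finite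
module of differentials of `R` over `k`: the `R`-module `Ω` is finitely generated, and every
`k`-derivation from `R` to a finitely generated `R`-module factors uniquely through `d`.
(Every finitely generated `R`-module has an isomorphic copy in the universe of `R`.) -/
def IsUniversallyFinite {k : Type u} {R : Type v} [Field k] [CommRing R] [Algebra k R]
    {Ω : Type w} [AddCommGroup Ω] [Module R Ω] [Module k Ω] [IsScalarTower k R Ω]
    (d : Derivation k R Ω) : Prop :=
  Module.Finite R Ω ∧
    ∀ (N : Type v) [AddCommGroup N] [Module R N] [Module k N] [IsScalarTower k R N]
      [Module.Finite R N] (δ : Derivation k R N), ∃! f : Ω →ₗ[R] N, ∀ r, f (d r) = δ r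

/-! Torsion: the pure powers `x₁ = t ^ a₁` and `xₙ = t ^ aₙ` satisfy `x₁ ^ aₙ = xₙ ^ a₁`. Applying
`d` and multiplying by `x₁ xₙ` gives `x₁ ^ aₙ • ω = 0` (`Derivation.smul_sub_smul_mem_torsion`).

Nonvanishing: `x₁` and `xₙ` have independent classes in `𝔪/𝔪²`, because a nontrivial combination
over `k` has one of the `aᵢ` as its value, and these are not values on `𝔪²`. Dual functionals give
derivations `D₁, D₂` from `R` to its residue field `K`. They twist the action of `R` on `K² ⊕ K`
(`WedgeModule`), and the antisymmetry of the twist makes `r ↦ (D₁ r, D₂ r, 0)` a derivation. The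
induced map on differentials sends `ω` to an element with last coordinate `-(a₁ + aₙ)`, which is
nonzero in characteristic zero (`IsUniversallyFinite.smul_sub_smul_ne_zero`).

Parametrization: a nonzero conductor makes `R̄` finite over `R`, hence a complete discrete valuation
ring with residue field `k`. By Hensel an element of value `a₁` is an `a₁`-th power of a
uniformizer, which is taken as `t`. As the conductor is not inside `𝔪²`, it contains an element
whose value is some `aⱼ ≤ aₙ`. It is an ideal of `R̄`, so `t ^ aₙ` lies in `R`. Comparing values,
with Nakayama, shows that Herzog–Kunz generators generate `𝔪`. -/

section Completeness

/-! ### Finite modules over complete rings. -/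

variable {R : Type*} [CommRing R] (I : Ideal R)

theorem IsPrecomplete.pi {ι : Type*} [Finite ι] (M : ι → Type*) [∀ i, AddCommGroup (M i)]
    [∀ i, Module R (M i)] [∀ i, IsPrecomplete I (M i)] : IsPrecomplete I (∀ i, M i) := by
  classical
  have := Fintype.ofFinite ι
  rw [← AdicCompletion.of_surjective_iff]
  intro x
  choose y hy using fun i ↦
    AdicCompletion.of_surjective I (M i) (AdicCompletion.piEquivOfFintype I M x i)
  refine ⟨y, (AdicCompletion.piEquivOfFintype I M).injective (funext fun i ↦ ?_)⟩
  rw [← hy i, AdicCompletion.piEquivOfFintype_apply]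
  exact AdicCompletion.map_of I _ _

theorem IsPrecomplete.of_surjective {M N : Type*} [AddCommGroup M] [Module R M] [AddCommGroup N]
    [Module R N] [IsPrecomplete I M] {f : M →ₗ[R] N} (hf : Function.Surjective f) :
    IsPrecomplete I N := by
  rw [← AdicCompletion.of_surjective_iff]
  intro y
  obtain ⟨x, rfl⟩ := AdicCompletion.map_surjective I hf y
  obtain ⟨x, rfl⟩ := AdicCompletion.of_surjective I M x
  exact ⟨f x, (AdicCompletion.map_of I f x).symm⟩

theorem IsPrecomplete.of_finite (M : Type*) [AddCommGroup M] [Module R M] [Module.Finite R M]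
    [IsPrecomplete I R] : IsPrecomplete I M := by
  obtain ⟨n, f, hf⟩ := Module.Finite.exists_fin' R M
  have := IsPrecomplete.pi I fun _ : Fin n ↦ R
  exact IsPrecomplete.of_surjective I hf

/-- Separatedness is Krull's intersection theorem, supplied by instance search. -/
theorem IsAdicComplete.of_finite [IsLocalRing R] [IsNoetherianRing R]
    [IsAdicComplete (maximalIdeal R) R] (M : Type*) [AddCommGroup M] [Module R M]
    [Module.Finite R M] : IsAdicComplete (maximalIdeal R) M where
  toIsPrecomplete := IsPrecomplete.of_finite _ M

/-- A Hausdorff module over a complete ring which is generated by finitely many elements modulo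
the ideal is finitely generated. -/
theorem Module.Finite.of_isHausdorff [IsPrecomplete I R] {M : Type*} [AddCommGroup M]
    [Module R M] [IsHausdorff I M] {ι : Type*} [Finite ι] (y : ι → M)
    (hy : Submodule.span R (Set.range y) ⊔ I • ⊤ = ⊤) : Module.Finite R M := by
  classical
  have := Fintype.ofFinite ι
  have := IsPrecomplete.pi I fun _ : ι ↦ R
  refine Module.Finite.of_surjective (Fintype.linearCombination R y)
    (surjective_of_mkQ_comp_surjective (I := I) ?_)
  rw [← LinearMap.range_eq_top, LinearMap.range_comp, Fintype.range_linearCombination,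
    ← Submodule.range_mkQ (I • ⊤ : Submodule R M), ← Submodule.map_top]
  have h := congrArg (Submodule.map (I • ⊤ : Submodule R M).mkQ) hy
  rwa [Submodule.map_sup, Submodule.mkQ_map_self, sup_bot_eq] at h

end Completeness

/-! ### Existence of the universally finite differentials. -/

section Differentials

variable {k : Type u} {R : Type v} [Field k] [CommRing R] [IsLocalRing R] [Algebra k R]

theorem exists_sub_algebraMap_mem (hres : Function.Surjective (algebraMap k (ResidueField R)))
    (r : R) : ∃ c : k, r - algebraMap k R c ∈ maximalIdeal R := by
  obtain ⟨c, hc⟩ := hres (residue R r)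
  refine ⟨c, (residue_eq_zero_iff _).1 ?_⟩
  rw [map_sub, sub_eq_zero, ← hc]
  rfl

/-- Constants have zero differential, so only `d r` with `r ∈ 𝔪` matters; in `d (a x) = a dx + x da`
the last term lies in `𝔪 Ω`. -/
theorem KaehlerDifferential.span_sup_smul_top
    (hres : Function.Surjective (algebraMap k (ResidueField R))) {s : Set R}
    (hs : Ideal.span s = maximalIdeal R) :
    Submodule.span R (KaehlerDifferential.D k R '' s) ⊔
      maximalIdeal R • (⊤ : Submodule R (KaehlerDifferential k R)) = ⊤ := by
  refine eq_top_iff.2 ((KaehlerDifferential.span_range_derivation k R).ge.trans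
    (Submodule.span_le.2 ?_))
  rintro _ ⟨r, rfl⟩
  obtain ⟨c, hc⟩ := exists_sub_algebraMap_mem hres r
  have hr : KaehlerDifferential.D k R r = KaehlerDifferential.D k R (r - algebraMap k R c) := by
    simp
  rw [hr, SetLike.mem_coe]
  have hsm : s ⊆ maximalIdeal R := hs ▸ Ideal.subset_span
  rw [← hs] at hc
  refine Submodule.span_induction (fun x hx ↦ ?_) (by simp) (fun x y _ _ hx hy ↦ ?_)
    (fun a x hxs hx ↦ ?_) hc
  · exact Submodule.mem_sup_left (Submodule.subset_span ⟨x, hx, rfl⟩)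
  · rw [map_add]
    exact add_mem hx hy
  · rw [smul_eq_mul, Derivation.leibniz]
    refine add_mem (Submodule.smul_mem _ _ hx) (Submodule.mem_sup_right ?_)
    exact Submodule.smul_mem_smul (hs ▸ hxs) Submodule.mem_top

/-- The `𝔪`-adically separated quotient of the Kähler differentials works: finite modules are
separated, so maps into them factor through it, and completeness makes it finite. -/
theorem exists_isUniversallyFinite [IsNoetherianRing R] [IsAdicComplete (maximalIdeal R) R]
    (hres : Function.Surjective (algebraMap k (ResidueField R))) :
    ∃ (Ω : Type v) (_ : AddCommGroup Ω) (_ : Module R Ω) (_ : Module k Ω)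
      (_ : IsScalarTower k R Ω) (d : Derivation k R Ω), IsUniversallyFinite d := by
  let I := maximalIdeal R
  let P : Submodule R (KaehlerDifferential k R) := ⨅ n : ℕ, I ^ n • ⊤
  have hH : IsHausdorff I (KaehlerDifferential k R ⧸ P) :=
    inferInstanceAs (IsHausdorff I (Hausdorffification I (KaehlerDifferential k R)))
  let d : Derivation k R (KaehlerDifferential k R ⧸ P) :=
    P.mkQ.compDer (KaehlerDifferential.D k R)
  refine ⟨KaehlerDifferential k R ⧸ P, inferInstance, inferInstance, inferInstance,
    inferInstance, d, ?_, ?_⟩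
  · obtain ⟨s, hs⟩ := (maximalIdeal R).fg_of_isNoetherianRing
    refine Module.Finite.of_isHausdorff I (fun x : s ↦ d x) ?_
    have h := congrArg (Submodule.map P.mkQ) (KaehlerDifferential.span_sup_smul_top hres hs)
    rw [Submodule.map_sup, Submodule.map_span, Submodule.map_smul'', Submodule.map_top,
      Submodule.range_mkQ, ← Set.image_comp] at h
    rw [← h]
    congr 2
    ext z
    simp [d]
  · intro N _ _ _ _ _ δ
    refine ⟨Hausdorffification.lift I δ.liftKaehlerDifferential, fun r ↦ ?_, fun g hg ↦ ?_⟩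
    · exact δ.liftKaehlerDifferential_comp_D r
    · refine Hausdorffification.lift_eq I _ g ?_
      refine Derivation.liftKaehlerDifferential_unique _ _ (Derivation.ext fun r ↦ ?_)
      rw [δ.liftKaehlerDifferential_comp]
      exact hg r

end Differentials

/-! ### Power series as parametrizations. -/

section PowerSeries

variable {k : Type*} [Field k] {S : Type*} [CommRing S] [IsLocalRing S] [Algebra k S]

theorem MvPowerSeries.exists_algHom [IsAdicComplete (maximalIdeal S) S] {σ : Type*} [Finite σ]
    (x : σ → S) (hx : ∀ i, x i ∈ maximalIdeal S) :
    ∃ φ : MvPowerSeries σ k →ₐ[k] S, ∀ i, φ (MvPowerSeries.X i) = x i := by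
  -- With the `𝔪`-adic topology on `S` and the discrete one on `k`, elements of `𝔪` are
  -- topologically nilpotent and can be substituted into power series.
  let : WithIdeal S := ⟨maximalIdeal S⟩
  have hI : IsAdic (maximalIdeal S) := rfl
  obtain ⟨_, _⟩ := hI.isAdicComplete_iff.1 ‹_›
  let : UniformSpace k := ⊥
  have : DiscreteTopology k := ⟨rfl⟩
  have : ContinuousSMul k S := continuousSMul_of_algebraMap k S continuous_of_discreteTopology
  have hE : MvPowerSeries.HasEval x := by
    refine ⟨fun i ↦ ?_, ?_⟩
    · refine (hI.hasBasis_nhds_zero.tendsto_right_iff).2 fun n _ ↦ ?_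
      filter_upwards [Filter.eventually_ge_atTop n] with m hm
      exact Ideal.pow_le_pow_right hm (Ideal.pow_mem_pow (hx i) m)
    · rw [Filter.cofinite_eq_bot]
      exact Filter.tendsto_bot
  refine ⟨MvPowerSeries.aeval hE, fun i ↦ ?_⟩
  rw [← MvPolynomial.coe_X, MvPowerSeries.aeval_coe, MvPolynomial.aeval_X]

/-- A surjective specialization of power series at generators of the maximal ideal. -/
theorem MvPowerSeries.surjective_of_span_eq_maximalIdeal [IsHausdorff (maximalIdeal S) S]
    (hres : Function.Surjective (algebraMap k (ResidueField S))) {σ : Type*} [Finite σ]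
    {x : σ → S} (hx : Ideal.span (Set.range x) = maximalIdeal S)
    {φ : MvPowerSeries σ k →ₐ[k] S} (hφ : ∀ i, φ (MvPowerSeries.X i) = x i) :
    Function.Surjective φ := by
  let I : Ideal (MvPowerSeries σ k) := Ideal.span (Set.range MvPowerSeries.X)
  have hmap : I.map (φ : MvPowerSeries σ k →+* S) = maximalIdeal S := by
    rw [Ideal.map_span, ← hx, ← Set.range_comp]
    congr 2
    exact funext hφ
  have : IsHausdorff (I.map (φ : MvPowerSeries σ k →+* S)) S := by rwa [hmap]
  refine surjective_of_mk_map_comp_surjective (I := I) (φ : MvPowerSeries σ k →+* S) fun y ↦ ?_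
  obtain ⟨y, rfl⟩ := Ideal.Quotient.mk_surjective y
  obtain ⟨c, hc⟩ := exists_sub_algebraMap_mem hres y
  refine ⟨algebraMap k _ c, ?_⟩
  rw [RingHom.comp_apply, eq_comm, Ideal.Quotient.eq, hmap]
  simpa using hc

theorem isPowerSeriesGenerated_of_span_eq_maximalIdeal [IsAdicComplete (maximalIdeal S) S]
    (hres : Function.Surjective (algebraMap k (ResidueField S))) {n : ℕ} {x : Fin n → S}
    (hx : Ideal.span (Set.range x) = maximalIdeal S) : IsPowerSeriesGenerated k x := by
  obtain ⟨φ, hφ⟩ := MvPowerSeries.exists_algHom (k := k) x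
    fun i ↦ hx ▸ Ideal.subset_span (Set.mem_range_self i)
  exact ⟨φ, hφ, MvPowerSeries.surjective_of_span_eq_maximalIdeal hres hx hφ⟩

/-- A complete discrete valuation ring with coefficient field `k` is a power series ring over `k`
in any of its uniformizers. -/
theorem exists_powerSeries_algEquiv {S : Type*} [CommRing S] [IsDomain S]
    [IsDiscreteValuationRing S] [Algebra k S] [IsAdicComplete (maximalIdeal S) S]
    (hres : Function.Surjective (algebraMap k (ResidueField S))) {π : S} (hπ : Irreducible π) :
    ∃ t : PowerSeries k ≃ₐ[k] S, t PowerSeries.X = π := by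
  have hx : Ideal.span (Set.range fun _ : Unit ↦ π) = maximalIdeal S := by
    rw [Set.range_const, hπ.maximalIdeal_eq]
  obtain ⟨φ, hφ⟩ := MvPowerSeries.exists_algHom (k := k) (fun _ : Unit ↦ π)
    fun i ↦ hx ▸ Ideal.subset_span (Set.mem_range_self i)
  have hsurj := MvPowerSeries.surjective_of_span_eq_maximalIdeal hres hx hφ
  let ψ : PowerSeries k →ₐ[k] S := φ
  have hψ : ψ PowerSeries.X = π := hφ ()
  have hinj : Function.Injective ψ := by
    rw [injective_iff_map_eq_zero]
    intro f hf
    by_contra hf0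
    rw [← PowerSeries.X_pow_order_mul_divXPowOrder (f := f), map_mul, map_pow, hψ] at hf
    refine mul_ne_zero (pow_ne_zero _ hπ.ne_zero) ?_ hf
    exact ((PowerSeries.isUnit_divided_by_X_pow_order hf0).map ψ).ne_zero
  exact ⟨AlgEquiv.ofBijective ψ ⟨hinj, hsurj⟩, hψ⟩

end PowerSeries

/-! ### The normalization is a complete discrete valuation ring. -/

section Normalization

/-- A Dedekind domain which is henselian along a nonzero proper ideal is local. -/
theorem IsLocalRing.of_henselianRing {S : Type*} [CommRing S] [IsDedekindDomain S] {J : Ideal S}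
    [HenselianRing S J] (hJ : J ≠ ⊥) : IsLocalRing S := by
  classical
  have hle : ∀ M : Ideal S, M.IsMaximal → J ≤ M := fun M hM ↦
    (HenselianRing.jac (I := J)).trans (sInf_le ⟨bot_le, hM⟩)
  obtain ⟨M, hM⟩ := Ideal.exists_maximal S
  refine IsLocalRing.of_unique_max_ideal ⟨M, hM, fun M' hM' ↦ ?_⟩
  have hMp : Prime M := (Ideal.prime_iff_isPrime (fun h ↦ hJ (le_bot_iff.1 (h ▸ hle M hM)))).2
    hM.isPrime
  -- With `a + b = 1`, `a ∈ M ^ e`, `b ∈ K`, the element `a` is idempotent modulo `J = M ^ e * K`.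
  -- Hensel lifts it to an idempotent of the domain, so to `0` or `1`: `0` forces `K = ⊤`, leaving
  -- only `M`, and `1` forces `M = ⊤`.
  obtain ⟨e, K, hJK, hK⟩ : ∃ (e : ℕ) (K : Ideal S), J = M ^ e * K ∧ ¬M ∣ K :=
    ⟨_, (FiniteMultiplicity.of_prime_left hMp hJ).exists_eq_pow_mul_and_not_dvd⟩
  have he : e ≠ 0 := by
    rintro rfl
    rw [pow_zero, one_mul] at hJK
    exact hK (Ideal.dvd_iff_le.2 (hJK ▸ hle M hM))
  have hco : IsCoprime (M ^ e) K := by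
    refine IsCoprime.pow_left (Ideal.isCoprime_iff_sup_eq.2 (hM.1.2 _ ?_))
    exact left_lt_sup.2 fun h ↦ hK (Ideal.dvd_iff_le.2 h)
  obtain ⟨a, ha, b, hb, hab⟩ := Ideal.isCoprime_iff_exists.1 hco
  have habJ : a * b ∈ J := hJK ▸ Ideal.mul_mem_mul ha hb
  have hb' : b = 1 - a := by rw [← hab]; ring
  obtain ⟨x, hx, hxa⟩ := HenselianRing.is_henselian (I := J)
    (Polynomial.X ^ 2 - Polynomial.X) (by monicity!) a (by
      rw [show (Polynomial.X ^ 2 - Polynomial.X : Polynomial S).eval a = -(a * b) by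
        simp [hb']; ring]
      exact neg_mem habJ) (by
      -- The derivative at `a` is `2a - 1`, its own inverse modulo `J` since `(2a - 1)² - 1 = -4ab`.
      refine IsUnit.of_mul_eq_one (Ideal.Quotient.mk J (2 * a - 1)) ?_
      rw [← map_mul, ← map_one (Ideal.Quotient.mk J), Ideal.Quotient.eq]
      rw [show (Polynomial.X ^ 2 - Polynomial.X : Polynomial S).derivative.eval a * (2 * a - 1) - 1
        = (-4) * (a * b) by simp [hb']; ring]
      exact Ideal.mul_mem_left _ _ habJ)
  have hx' : x * (x - 1) = 0 := by
    have : x ^ 2 - x = 0 := by simpa using hx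
    linear_combination this
  rcases mul_eq_zero.1 hx' with h | h
  · have haK : a ∈ K := by
      have : a ∈ J := by simpa [h] using neg_mem hxa
      have hJK' : J ≤ K := hJK.trans_le Ideal.mul_le_right
      exact hJK' this
    have hK1 : K = ⊤ := (Ideal.eq_top_iff_one K).2 (hab ▸ add_mem haK hb)
    rw [hK1, Ideal.mul_top] at hJK
    have h' := hle M' hM'
    rw [hJK] at h'
    exact (hM.eq_of_le hM'.ne_top ((hM'.isPrime.pow_le_iff he).1 h')).symm
  · refine absurd ((Ideal.eq_top_iff_one M).2 ?_) hM.ne_top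
    have hbJ : b ∈ J := by
      rw [hb']
      rwa [← sub_eq_zero.1 h]
    rw [← hab]
    exact add_mem (Ideal.pow_le_self he ha) (hle M hM hbJ)

variable {k : Type u} {R : Type v} [Field k] [CommRing R] [IsDomain R] [Algebra k R]

theorem Normalization.algebraMap_injective :
    Function.Injective (algebraMap R (Normalization R)) :=
  FaithfulSMul.algebraMap_injective _ _

/-- Multiplication by a nonzero conductor element embeds `R̄` into the noetherian module `R`. -/
theorem Normalization.finite_of_conductorIdeal_ne_bot [IsNoetherianRing R]
    (hC : conductorIdeal R ≠ ⊥) : Module.Finite R (Normalization R) := by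
  obtain ⟨c, hc, hc0⟩ := Submodule.exists_mem_ne_zero_of_ne_bot hC
  choose f hf using hc
  have hinj := Normalization.algebraMap_injective (R := R)
  let g : Normalization R →ₗ[R] R :=
    { toFun := f
      map_add' := fun x y ↦ hinj (by rw [map_add, hf, hf, hf, mul_add])
      map_smul' := fun r x ↦ hinj (by
        rw [smul_eq_mul, map_mul, RingHom.id_apply, hf, hf, Algebra.smul_def]; ring) }
  refine Module.Finite.of_injective g fun x y hxy ↦ ?_
  have h : f x = f y := hxy
  have h2 := (hf x).symm.trans ((congrArg _ h).trans (hf y))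
  exact mul_left_cancel₀ ((map_ne_zero_iff _ hinj).2 hc0) h2

omit [IsDomain R] in
theorem ne_bot_of_ringKrullDim_eq_one [IsLocalRing R] (hdim : ringKrullDim R = 1) :
    maximalIdeal R ≠ ⊥ := by
  intro h
  have hF := IsLocalRing.isField_iff_maximalIdeal_eq.2 h
  rw [ringKrullDim_eq_zero_of_isField hF] at hdim
  exact zero_ne_one hdim

theorem Normalization.isDedekindDomain [IsNoetherianRing R] (hdim : ringKrullDim R = 1)
    [Module.Finite R (Normalization R)] : IsDedekindDomain (Normalization R) := by
  have : Ring.KrullDimLE 1 R := by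
    rw [Ring.krullDimLE_iff, hdim]
    rfl
  have : Ring.DimensionLEOne R := ⟨fun h0 h ↦ h.isMaximal_of_ne_bot h0⟩
  have : IsNoetherianRing (Normalization R) := IsNoetherianRing.of_finite R _
  have : IsIntegrallyClosed (Normalization R) :=
    integralClosure.isIntegrallyClosedOfFiniteExtension (FractionRing R)
  have : IsDedekindRing (Normalization R) := { }
  exact { }

/-- If `f` is `I`-adically Cauchy, then `n ↦ f (e * n)` is `I ^ e`-adically Cauchy, and its limit
serves for `f`. -/
theorem IsPrecomplete.of_pow {S : Type*} [CommRing S] {I : Ideal S} {e : ℕ} (he : e ≠ 0)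
    [IsPrecomplete (I ^ e) S] : IsPrecomplete I S := by
  refine ⟨fun f hf ↦ ?_⟩
  have hen : ∀ n, n ≤ e * n := fun n ↦ Nat.le_mul_of_pos_left n (Nat.pos_of_ne_zero he)
  obtain ⟨L, hL⟩ := IsPrecomplete.prec (I := I ^ e) ‹_› (f := fun n ↦ f (e * n)) fun {m n} hmn ↦ by
    rw [← pow_mul]
    exact hf (Nat.mul_le_mul_left e hmn)
  refine ⟨L, fun n ↦ (hf (hen n)).trans ((hL n).mono ?_)⟩
  rw [← pow_mul]
  exact Submodule.smul_mono_left (Ideal.pow_le_pow_right (hen n))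

variable [IsLocalRing R] [IsNoetherianRing R]

omit [IsNoetherianRing R] in
theorem Normalization.map_maximalIdeal_ne_bot (hdim : ringKrullDim R = 1) :
    (maximalIdeal R).map (algebraMap R (Normalization R)) ≠ ⊥ :=
  (Ideal.map_eq_bot_iff_of_injective Normalization.algebraMap_injective).not.2
    (ne_bot_of_ringKrullDim_eq_one hdim)

variable [IsAdicComplete (maximalIdeal R) R]

theorem Normalization.isAdicComplete_map [Module.Finite R (Normalization R)] :
    IsAdicComplete ((maximalIdeal R).map (algebraMap R (Normalization R))) (Normalization R) :=
  (IsAdicComplete.map_algebraMap_iff _ _).2 (IsAdicComplete.of_finite _)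

theorem Normalization.isDiscreteValuationRing (hdim : ringKrullDim R = 1)
    [Module.Finite R (Normalization R)] : IsDiscreteValuationRing (Normalization R) := by
  have hD := Normalization.isDedekindDomain hdim
  have := Normalization.isAdicComplete_map (R := R)
  have hJ := Normalization.map_maximalIdeal_ne_bot hdim
  have := IsLocalRing.of_henselianRing hJ
  have hF : ¬IsField (Normalization R) := by
    intro hF
    have hJM := (IsAdicComplete.le_jacobson_bot
      ((maximalIdeal R).map (algebraMap R (Normalization R)))).trans
        (IsLocalRing.jacobson_eq_maximalIdeal ⊥ bot_ne_top).le
    rw [IsLocalRing.isField_iff_maximalIdeal_eq.1 hF] at hJM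
    exact hJ (le_bot_iff.1 hJM)
  exact ((IsDiscreteValuationRing.TFAE (Normalization R) hF).out 0 2).2 hD

/-- The extended ideal `𝔪 R̄` is a positive power of the maximal ideal of `R̄`. -/
theorem Normalization.isAdicComplete (hdim : ringKrullDim R = 1)
    [Module.Finite R (Normalization R)] [IsDiscreteValuationRing (Normalization R)] :
    IsAdicComplete (maximalIdeal (Normalization R)) (Normalization R) := by
  have hc := Normalization.isAdicComplete_map (R := R)
  have hJ := Normalization.map_maximalIdeal_ne_bot hdim
  have hJM := (IsAdicComplete.le_jacobson_bot
      ((maximalIdeal R).map (algebraMap R (Normalization R)))).trans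
        (IsLocalRing.jacobson_eq_maximalIdeal ⊥ bot_ne_top).le
  obtain ⟨e, he⟩ := exists_maximalIdeal_pow_eq_of_principal (Normalization R)
    (IsPrincipalIdealRing.principal _) _ hJ
  have he0 : e ≠ 0 := by
    rintro rfl
    rw [he, pow_zero, Ideal.one_eq_top, top_le_iff] at hJM
    exact (maximalIdeal.isMaximal _).ne_top hJM
  rw [he] at hc
  exact { toIsPrecomplete := IsPrecomplete.of_pow he0 }

omit [IsNoetherianRing R] [IsAdicComplete (maximalIdeal R) R] in
theorem Normalization.residueField_surjective [IsAlgClosed k]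
    (hres : Function.Surjective (algebraMap k (ResidueField R)))
    [IsLocalRing (Normalization R)] :
    Function.Surjective (algebraMap k (ResidueField (Normalization R))) := by
  have : IsScalarTower k (ResidueField R) (ResidueField (Normalization R)) :=
    IsScalarTower.of_algebraMap_eq fun _ ↦ rfl
  have : Algebra.IsIntegral k (ResidueField R) := Algebra.isIntegral_of_surjective hres
  have : Algebra.IsIntegral R (ResidueField (Normalization R)) :=
    Algebra.IsIntegral.trans (Normalization R)
  have : Algebra.IsIntegral (ResidueField R) (ResidueField (Normalization R)) :=
    Algebra.IsIntegral.tower_top R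
  have : Algebra.IsIntegral k (ResidueField (Normalization R)) :=
    Algebra.IsIntegral.trans (ResidueField R)
  exact IsAlgClosed.algebraMap_bijective_of_isIntegral.2

end Normalization

/-! ### Orders of power series and roots of elements. -/

section PowerSeriesOrder

variable {k : Type*} [Field k]

theorem PowerSeries.dvd_of_order_le {f g : PowerSeries k} (h : f.order ≤ g.order) : f ∣ g := by
  by_cases hf : f = 0
  · rw [hf, PowerSeries.order_zero, top_le_iff, PowerSeries.order_eq_top] at h
    rw [h]
    exact dvd_zero f
  by_cases hg : g = 0
  · rw [hg]
    exact dvd_zero f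
  rw [← PowerSeries.X_pow_order_mul_divXPowOrder (f := f),
    ← PowerSeries.X_pow_order_mul_divXPowOrder (f := g)]
  refine mul_dvd_mul (pow_dvd_pow _ (ENat.toNat_le_toNat h ?_))
    (PowerSeries.isUnit_divided_by_X_pow_order hf).dvd
  exact (PowerSeries.order_finite_iff_ne_zero.2 hg).ne

theorem PowerSeries.exists_lt_order_sub_smul {f g : PowerSeries k} {n : ℕ} (hf : f.order = n)
    (hg : g.order = n) : ∃ c : k, (n : ℕ∞) < (g - c • f).order := by
  have hfn : PowerSeries.coeff n f ≠ 0 := (PowerSeries.order_eq_nat.1 hf).1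
  refine ⟨PowerSeries.coeff n g / PowerSeries.coeff n f, ?_⟩
  refine lt_of_lt_of_le (ENat.natCast_lt_natCast.2 n.lt_succ_self)
    (PowerSeries.nat_le_order _ _ fun i hi ↦ ?_)
  rcases Nat.lt_succ_iff_lt_or_eq.1 hi with hi | rfl
  · simp [(PowerSeries.order_eq_nat.1 hf).2 i hi, (PowerSeries.order_eq_nat.1 hg).2 i hi]
  · simp [hfn]

/-- A linear combination of power series of distinct orders has the order of one of its terms. -/
theorem PowerSeries.exists_order_sum_smul_eq {ι : Type*} {f : ι → PowerSeries k} {a : ι → ℕ}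
    (ha : Function.Injective a) (hf : ∀ i, (f i).order = a i) (s : Finset ι) (c : ι → k)
    (hc : ∃ i ∈ s, c i ≠ 0) : ∃ i, (∑ j ∈ s, c j • f j).order = a i := by
  classical
  obtain ⟨i₁, hi₁, hc₁⟩ := hc
  -- Among the terms with nonzero coefficient, the one of least order cannot be cancelled.
  obtain ⟨i, hi, hmin⟩ := (s.filter fun i ↦ c i ≠ 0).exists_min_image a ⟨i₁, by simp [hi₁, hc₁]⟩
  obtain ⟨his, hci⟩ := Finset.mem_filter.1 hi
  have hlt : ∀ j ∈ s, ∀ m : ℕ, (m < a i ∨ m = a i ∧ j ≠ i) →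
      PowerSeries.coeff m (c j • f j) = 0 := by
    intro j hj m hm
    by_cases hcj : c j = 0
    · simp [hcj]
    have hle := hmin j (by simp [hj, hcj])
    have : m < a j := by
      rcases hm with hm | ⟨rfl, hji⟩
      · omega
      · exact lt_of_le_of_ne hle fun h ↦ hji (ha h.symm)
    simp [(PowerSeries.order_eq_nat.1 (hf j)).2 m this]
  refine ⟨i, PowerSeries.order_eq_nat.2 ⟨?_, fun m hm ↦ ?_⟩⟩
  · rw [map_sum, Finset.sum_eq_single_of_mem i his fun j hj hji ↦ hlt j hj _ (Or.inr ⟨rfl, hji⟩)]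
    simpa [hci] using (PowerSeries.order_eq_nat.1 (hf i)).1
  · rw [map_sum]
    exact Finset.sum_eq_zero fun j hj ↦ hlt j hj m (Or.inl hm)

/-- Any two uniformizers of a discrete valuation ring are associated. -/
theorem PowerSeries.order_symm_eq {S : Type*} [CommRing S] [Algebra k S]
    (t t' : PowerSeries k ≃ₐ[k] S) (y : S) : (t.symm y).order = (t'.symm y).order := by
  let e : PowerSeries k ≃ₐ[k] PowerSeries k := t.trans t'.symm
  have h1 : (t.symm y).order = emultiplicity (e PowerSeries.X) (t'.symm y) := by
    rw [PowerSeries.order_eq_emultiplicity_X, ← emultiplicity_map_eq e]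
    simp [e]
  have hirr : Irreducible (e PowerSeries.X) :=
    (MulEquiv.irreducible_iff e).2 PowerSeries.X_irreducible
  have hX : Irreducible (PowerSeries.X : PowerSeries k) := PowerSeries.X_irreducible
  rw [h1, PowerSeries.order_eq_emultiplicity_X]
  exact emultiplicity_eq_of_associated_left
    (IsDiscreteValuationRing.associated_of_irreducible _ hX hirr)

/-- In a complete discrete valuation ring with algebraically closed coefficient field of
characteristic zero, an element of order `a ≠ 0` is the `a`-th power of a uniformizer. -/
theorem exists_irreducible_pow_eq [IsAlgClosed k] [CharZero k] {S : Type*} [CommRing S] [IsDomain S]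
    [IsDiscreteValuationRing S] [Algebra k S] [IsAdicComplete (maximalIdeal S) S]
    (hres : Function.Surjective (algebraMap k (ResidueField S)))
    (t : PowerSeries k ≃ₐ[k] S) {y : S} {a : ℕ} (ha : a ≠ 0) (hy : (t.symm y).order = a) :
    ∃ π : S, Irreducible π ∧ π ^ a = y := by
  have hy0 : t.symm y ≠ 0 := by
    rw [← PowerSeries.order_finite_iff_ne_zero, hy]
    exact ENat.natCast_lt_top a
  have hX : Irreducible (t PowerSeries.X) :=
    (MulEquiv.irreducible_iff t).2 PowerSeries.X_irreducible
  obtain ⟨u, hu, hyu⟩ : ∃ u : S, IsUnit u ∧ y = t PowerSeries.X ^ a * u := by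
    refine ⟨t (t.symm y).divXPowOrder, (PowerSeries.isUnit_divided_by_X_pow_order hy0).map t, ?_⟩
    rw [← map_pow, ← map_mul, eq_comm]
    have h := PowerSeries.X_pow_order_mul_divXPowOrder (f := t.symm y)
    rw [hy, ENat.toNat_natCast] at h
    rw [h, AlgEquiv.apply_symm_apply]
  obtain ⟨c, hc⟩ := exists_sub_algebraMap_mem hres u
  have hc0 : c ≠ 0 := by
    rintro rfl
    rw [map_zero, sub_zero] at hc
    exact hc hu
  -- `b` is an `a`-th root of the residue of `u`. Hensel lifts it to an `a`-th root of `u`, the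
  -- derivative `a * b ^ (a - 1)` being a nonzero constant in characteristic zero.
  obtain ⟨b, hb⟩ := IsAlgClosed.exists_pow_nat_eq c (Nat.pos_of_ne_zero ha)
  have hb0 : b ≠ 0 := by
    rintro rfl
    rw [zero_pow ha] at hb
    exact hc0 hb.symm
  obtain ⟨w, hw, -⟩ := HenselianRing.is_henselian (I := maximalIdeal S)
    (Polynomial.X ^ a - Polynomial.C u) (Polynomial.monic_X_pow_sub_C u ha) (algebraMap k S b) (by
      rw [Polynomial.eval_sub, Polynomial.eval_pow, Polynomial.eval_X, Polynomial.eval_C,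
        ← map_pow, hb, ← neg_sub]
      exact neg_mem hc) (by
      have hd : (Polynomial.X ^ a - Polynomial.C u : Polynomial S).derivative.eval
          (algebraMap k S b) = algebraMap k S (a * b ^ (a - 1)) := by
        simp [Polynomial.derivative_X_pow]
      rw [hd]
      refine IsUnit.map _ (IsUnit.map _ (IsUnit.mk0 _ ?_))
      exact mul_ne_zero (Nat.cast_ne_zero.2 ha) (pow_ne_zero _ hb0))
  have hwu : w ^ a = u := by
    simpa [sub_eq_zero] using hw
  have hwunit : IsUnit w := (isUnit_pow_iff ha).1 (hwu ▸ hu)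
  refine ⟨t PowerSeries.X * w, (irreducible_mul_isUnit hwunit).2 hX, ?_⟩
  rw [mul_pow, hwu, hyu]

end PowerSeriesOrder

/-! ### Values of elements and ideals. -/

section Values

variable {k : Type u} {R : Type v} [Field k] [CommRing R] [IsDomain R] [Algebra k R]
  (t : PowerSeries k ≃ₐ[k] Normalization R)

theorem tVal_eq_top {r : R} : tVal t r = ⊤ ↔ r = 0 := by
  rw [tVal, PowerSeries.order_eq_top, map_eq_zero_iff _ t.symm.injective,
    map_eq_zero_iff _ Normalization.algebraMap_injective]

theorem exists_tVal_eq_coe {r : R} (hr : r ≠ 0) : ∃ n : ℕ, tVal t r = n :=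
  ⟨_, (ENat.natCast_toNat ((tVal_eq_top t).not.2 hr)).symm⟩

theorem dvd_of_tVal_le {r : R} {y : Normalization R} (h : tVal t r ≤ (t.symm y).order) :
    algebraMap R (Normalization R) r ∣ y := by
  have := map_dvd t (PowerSeries.dvd_of_order_le h)
  simpa using this

theorem symm_algebraMap_algebraMap_mul (c : k) (r : R) :
    t.symm (algebraMap R (Normalization R) (algebraMap k R c * r)) =
      c • t.symm (algebraMap R (Normalization R) r) := by
  rw [← map_smul, map_mul, ← IsScalarTower.algebraMap_apply, Algebra.smul_def]

theorem exists_lt_tVal_sub {f g : R} {n : ℕ} (hf : tVal t f = n) (hg : tVal t g = n) :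
    ∃ c : k, (n : ℕ∞) < tVal t (g - algebraMap k R c * f) := by
  obtain ⟨c, hc⟩ := PowerSeries.exists_lt_order_sub_smul hf hg
  refine ⟨c, ?_⟩
  rwa [tVal, map_sub, map_sub, symm_algebraMap_algebraMap_mul]

theorem exists_algebraMap_eq_of_mem_conductorIdeal {f : R} (hf : f ∈ conductorIdeal R)
    {y : Normalization R} (h : tVal t f ≤ (t.symm y).order) :
    ∃ g ∈ conductorIdeal R, algebraMap R (Normalization R) g = y := by
  obtain ⟨z, rfl⟩ := dvd_of_tVal_le t h
  obtain ⟨g, hg⟩ := hf z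
  refine ⟨g, fun z' ↦ ?_, hg⟩
  obtain ⟨g', hg'⟩ := hf (z * z')
  exact ⟨g', by rw [hg', hg, mul_assoc]⟩

theorem mem_conductorIdeal_of_tVal_le {f g : R} (hf : f ∈ conductorIdeal R)
    (h : tVal t f ≤ tVal t g) : g ∈ conductorIdeal R := by
  obtain ⟨g', hg', hgg'⟩ := exists_algebraMap_eq_of_mem_conductorIdeal t hf h
  rwa [← Normalization.algebraMap_injective hgg']

/-- Every nonzero ideal contains all elements of large value. -/
theorem exists_forall_le_tVal_imp_mem (hC : conductorIdeal R ≠ ⊥) {W : Ideal R} (hW : W ≠ ⊥) :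
    ∃ N : ℕ, ∀ f : R, N ≤ tVal t f → f ∈ W := by
  obtain ⟨c, hc, hc0⟩ := Submodule.exists_mem_ne_zero_of_ne_bot hC
  obtain ⟨g, hg, hg0⟩ := Submodule.exists_mem_ne_zero_of_ne_bot hW
  -- Beyond `v (g c)` an element is `g * (c * z)` with `z ∈ R̄`, and `c * z ∈ R` by the conductor
  -- property.
  obtain ⟨N, hN⟩ := exists_tVal_eq_coe t (mul_ne_zero hg0 hc0)
  refine ⟨N, fun f hf ↦ ?_⟩
  obtain ⟨z, hz⟩ := dvd_of_tVal_le t (hN.trans_le hf)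
  obtain ⟨s, hs⟩ := hc z
  have : f = s * g := Normalization.algebraMap_injective (by rw [hz, map_mul, map_mul, hs]; ring)
  exact this ▸ W.mul_mem_left s hg

/-- An ideal which attains on `W` all its values is contained in `W`. -/
theorem le_of_forall_exists_tVal_eq (hC : conductorIdeal R ≠ ⊥) {J W : Ideal R} (hW : W ≠ ⊥)
    (h : ∀ f ∈ J, f ≠ 0 → ∃ g ∈ W ⊓ J, tVal t g = tVal t f) : J ≤ W := by
  obtain ⟨N, hN⟩ := exists_forall_le_tVal_imp_mem t hC hW
  -- Induction on how far the value of `f` may lie below `N`: cancelling the leading term with an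
  -- element of `W ⊓ J` raises the value.
  have key : ∀ n : ℕ, ∀ f ∈ J, (N : ℕ∞) ≤ tVal t f + n → f ∈ W := by
    intro n
    induction n with
    | zero => exact fun f _ hf ↦ hN f (by simpa using hf)
    | succ n ih =>
      intro f hfJ hf
      by_cases hf0 : f = 0
      · exact hf0 ▸ W.zero_mem
      obtain ⟨g, ⟨hgW, hgJ⟩, hgf⟩ := h f hfJ hf0
      obtain ⟨p, hp⟩ := exists_tVal_eq_coe t hf0
      obtain ⟨c, hc⟩ := exists_lt_tVal_sub t (hgf.trans hp) hp
      have h1 : f - algebraMap k R c * g ∈ W := by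
        refine ih _ (sub_mem hfJ (J.mul_mem_left _ hgJ)) (hf.trans ?_)
        rw [hp, Nat.cast_add, Nat.cast_one, add_comm (n : ℕ∞), ← add_assoc]
        gcongr
        exact Order.add_one_le_of_lt hc
      have h2 := add_mem h1 (W.mul_mem_left (algebraMap k R c) hgW)
      rwa [sub_add_cancel] at h2
  intro f hf
  exact key N f hf le_add_self

variable [IsLocalRing R]

theorem tVal_ne_zero_of_mem_maximalIdeal {r : R} (hr : r ∈ maximalIdeal R) : tVal t r ≠ 0 := by
  intro h
  rw [tVal] at h
  have h1 : IsUnit (t.symm (algebraMap R (Normalization R) r)) := by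
    rw [PowerSeries.isUnit_iff_constantCoeff, isUnit_iff_ne_zero]
    exact fun h' ↦ (PowerSeries.order_ne_zero_iff_constCoeff_eq_zero.2 h') h
  have h2 : IsUnit (algebraMap R (Normalization R) r) := by simpa using h1.map t
  exact hr (isUnit_of_map_unit _ _ h2)

theorem mem_maximalIdeal_of_tVal_ne_zero {r : R} (hr : tVal t r ≠ 0) : r ∈ maximalIdeal R := by
  intro h
  refine hr (PowerSeries.order_zero_of_unit ?_)
  exact (h.map (algebraMap R (Normalization R))).map t.symm

/-- A nontrivial relation lifts to coefficients in `k`, giving an element of `𝔪²` whose value is one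
of the distinct `aᵢ`, which is excluded. -/
theorem linearIndependent_toCotangent
    (hres : Function.Surjective (algebraMap k (ResidueField R))) {ι : Type*} {x : ι → R}
    (hx : ∀ i, x i ∈ maximalIdeal R) {a : ι → ℕ} (ha : Function.Injective a)
    (hxa : ∀ i, tVal t (x i) = a i) (ha' : ∀ i, a i ∉ valueSet t (maximalIdeal R ^ 2)) :
    LinearIndependent (ResidueField R)
      fun i ↦ ((maximalIdeal R).toCotangent ⟨x i, hx i⟩ : CotangentSpace R) := by
  rw [linearIndependent_iff']
  intro s g hg
  choose c hc using fun i ↦ hres (g i)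
  by_contra! hcon
  obtain ⟨i, his, hi⟩ := hcon
  obtain ⟨j, hj⟩ := PowerSeries.exists_order_sum_smul_eq ha hxa s c ⟨i, his, by
    rintro h
    rw [← hc, h, map_zero] at hi
    exact hi rfl⟩
  refine ha' j ⟨∑ i ∈ s, algebraMap k R (c i) * x i, ?_, ?_⟩
  · have h1 : (maximalIdeal R).toCotangent (∑ i ∈ s, algebraMap k R (c i) • ⟨x i, hx i⟩) = 0 := by
      rw [← hg, map_sum]
      refine Finset.sum_congr rfl fun i _ ↦ ?_
      rw [map_smul, ← hc]
      rfl
    rw [Ideal.toCotangent_eq_zero] at h1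
    simpa [Algebra.smul_def] using h1
  · rw [tVal, map_sum, map_sum, ← hj]
    simp_rw [symm_algebraMap_algebraMap_mul]

end Values

/-! ### Herzog–Kunz sequences and parametrizations. -/

section HerzogKunz

variable {k : Type u} {R : Type v} [Field k] [CommRing R] [IsDomain R] [IsLocalRing R]
  [IsNoetherianRing R] [Algebra k R] (t : PowerSeries k ≃ₐ[k] Normalization R)

/-- By Nakayama it suffices that `𝔪 ≤ (x) + 𝔪²`, and every value on `𝔪` is either attained on `𝔪²`
or is some `aᵢ`. -/
theorem span_range_eq_maximalIdeal (hC : conductorIdeal R ≠ ⊥) (hm : maximalIdeal R ≠ ⊥)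
    {ι : Type*} {x : ι → R} (hx : ∀ i, x i ∈ maximalIdeal R) {a : ι → ℕ}
    (hxa : ∀ i, tVal t (x i) = a i)
    (ha : valueSet t (maximalIdeal R) \ valueSet t (maximalIdeal R ^ 2) ⊆ Set.range a) :
    Ideal.span (Set.range x) = maximalIdeal R := by
  have hle : Ideal.span (Set.range x) ≤ maximalIdeal R :=
    Ideal.span_le.2 (Set.range_subset_iff.2 hx)
  refine le_antisymm hle ?_
  refine Submodule.le_of_le_smul_of_le_jacobson_bot
    (maximalIdeal R).fg_of_isNoetherianRing (IsLocalRing.maximalIdeal_le_jacobson ⊥) ?_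
  refine le_of_forall_exists_tVal_eq t hC
    (ne_bot_of_le_ne_bot (pow_ne_zero 2 hm) ?_) fun f hf hf0 ↦ ?_
  · rw [sq]
    exact le_sup_right
  obtain ⟨p, hp⟩ := exists_tVal_eq_coe t hf0
  by_cases hp2 : p ∈ valueSet t (maximalIdeal R ^ 2)
  · obtain ⟨g, hg, hgp⟩ := hp2
    refine ⟨g, ⟨Ideal.mem_sup_right (by rwa [sq] at hg), Ideal.pow_le_self two_ne_zero hg⟩, ?_⟩
    rw [hgp, hp]
  · obtain ⟨i, rfl⟩ := ha ⟨⟨f, hf, hp⟩, hp2⟩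
    exact ⟨x i, ⟨Ideal.mem_sup_left (Ideal.subset_span ⟨i, rfl⟩), hx i⟩, by rw [hxa, hp]⟩

/-- Choosing one element for each value in `v(𝔪) ∖ v(𝔪²)` yields a basis of the cotangent space, so
the number of values is the embedding dimension. -/
theorem exists_isHerzogKunzSequence (hC : conductorIdeal R ≠ ⊥) (hm : maximalIdeal R ≠ ⊥)
    (hres : Function.Surjective (algebraMap k (ResidueField R))) :
    ∃ (n : ℕ) (a : Fin (n + 1) → ℕ), IsHerzogKunzSequence t a := by
  classical
  let A := valueSet t (maximalIdeal R) \ valueSet t (maximalIdeal R ^ 2)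
  choose x hx hxa using fun p : A ↦ p.2.1
  have hli := linearIndependent_toCotangent t hres hx Subtype.val_injective hxa fun p ↦ p.2.2
  have hspan := span_range_eq_maximalIdeal t hC hm hx hxa (by rw [Subtype.range_coe])
  have htop : Submodule.span (ResidueField R)
      (Set.range fun p ↦ ((maximalIdeal R).toCotangent ⟨x p, hx p⟩ : CotangentSpace R)) = ⊤ := by
    have h := (CotangentSpace.span_image_eq_top_iff (R := R)
      (s := Set.range fun p ↦ (⟨x p, hx p⟩ : maximalIdeal R))).2 (by
        refine Submodule.map_injective_of_injective (maximalIdeal R).injective_subtype ?_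
        rw [Submodule.map_span, Submodule.map_top, Submodule.range_subtype,
          ← Set.range_comp]
        exact hspan)
    rwa [← Set.range_comp] at h
  let b := Module.Basis.mk hli htop.ge
  have hfin : Finite A := Module.Finite.finite_basis b
  have hcard : Nat.card A = Module.finrank (ResidueField R) (CotangentSpace R) :=
    (Module.finrank_eq_nat_card_basis b).symm
  have hne : Nonempty A := by
    by_contra h
    rw [not_nonempty_iff] at h
    rw [Set.range_eq_empty, Ideal.span_empty] at hspan
    exact hm hspan.symm
  obtain ⟨n, hn⟩ := Nat.exists_eq_succ_of_ne_zero (Nat.card_pos (α := A)).ne'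
  have hAf : A.Finite := hfin
  have hc : hAf.toFinset.card = n + 1 := by
    rw [← Nat.card_eq_card_finite_toFinset, hn]
  refine ⟨n, hAf.toFinset.orderEmbOfFin hc, ?_, ?_, ?_⟩
  · exact (hAf.toFinset.orderEmbOfFin hc).strictMono
  · rw [← hcard, hn]
  · rw [Finset.range_orderEmbOfFin, Set.Finite.coe_toFinset]

omit [IsLocalRing R] [IsNoetherianRing R] in
theorem tVal_eq_tVal (t t' : PowerSeries k ≃ₐ[k] Normalization R) : tVal t = tVal t' :=
  funext fun _ ↦ PowerSeries.order_symm_eq t t' _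

omit [IsNoetherianRing R] in
theorem IsHerzogKunzSequence.congr {t t' : PowerSeries k ≃ₐ[k] Normalization R} {n : ℕ}
    {a : Fin n → ℕ} (h : IsHerzogKunzSequence t a) : IsHerzogKunzSequence t' a where
  strictMono := h.strictMono
  edim := h.edim
  range_eq := by
    rw [h.range_eq]
    simp only [valueSet, tVal_eq_tVal t t']

/-- If the conductor is not contained in `𝔪²`, some member of the Herzog–Kunz sequence is the
value of an element of the conductor. -/
theorem exists_mem_conductorIdeal_tVal_mem (hm : maximalIdeal R ≠ ⊥)
    (hC : ¬conductorIdeal R ≤ maximalIdeal R ^ 2) :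
    ∃ f ∈ conductorIdeal R, ∃ p ∈ valueSet t (maximalIdeal R) \ valueSet t (maximalIdeal R ^ 2),
      tVal t f = p := by
  have hC0 : conductorIdeal R ≠ ⊥ := by
    intro h
    exact hC (h ▸ bot_le)
  -- The conductor may be all of `R`; then `𝔪 ≤ 𝔪²` would contradict Nakayama.
  have hJ : ¬conductorIdeal R ⊓ maximalIdeal R ≤ maximalIdeal R ^ 2 := by
    intro h
    by_cases hCm : conductorIdeal R ≤ maximalIdeal R
    · exact hC (by rwa [inf_eq_left.2 hCm] at h)
    · have htop : conductorIdeal R = ⊤ := by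
        by_contra htop
        exact hCm (IsLocalRing.le_maximalIdeal htop)
      rw [htop, top_inf_eq, sq] at h
      refine hm (Submodule.eq_bot_of_le_smul_of_le_jacobson_bot _ _
        (maximalIdeal R).fg_of_isNoetherianRing h (IsLocalRing.maximalIdeal_le_jacobson ⊥))
  by_contra! hcon
  refine hJ (le_of_forall_exists_tVal_eq t hC0 (pow_ne_zero 2 hm) ?_)
  rintro f ⟨hfC, hfm⟩ hf0
  obtain ⟨p, hp⟩ := exists_tVal_eq_coe t hf0
  have hp2 : p ∈ valueSet t (maximalIdeal R ^ 2) := by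
    by_contra hp2
    exact hcon f hfC p ⟨⟨f, hfm, hp⟩, hp2⟩ hp
  obtain ⟨g, hg, hgp⟩ := hp2
  refine ⟨g, ⟨hg, ?_, Ideal.pow_le_self two_ne_zero hg⟩, hgp.trans hp.symm⟩
  -- The element of `𝔪²` with the value of `f` is itself in the conductor, since membership depends
  -- only on the value.
  exact mem_conductorIdeal_of_tVal_le t hfC (hp.trans hgp.symm).le

theorem exists_isPureHerzogKunzParametrization [IsAlgClosed k] [CharZero k]
    [IsAdicComplete (maximalIdeal R) R] (hdim : ringKrullDim R = 1)
    (hres : Function.Surjective (algebraMap k (ResidueField R)))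
    (hC : ¬conductorIdeal R ≤ maximalIdeal R ^ 2) :
    ∃ (t : PowerSeries k ≃ₐ[k] Normalization R) (n : ℕ) (a : Fin (n + 1) → ℕ)
      (x : Fin (n + 1) → R), IsPureHerzogKunzParametrization t a x := by
  have hC0 : conductorIdeal R ≠ ⊥ := by
    intro h
    exact hC (h ▸ bot_le)
  have hm := ne_bot_of_ringKrullDim_eq_one hdim
  have := Normalization.finite_of_conductorIdeal_ne_bot hC0
  have := Normalization.isDiscreteValuationRing hdim
  have := Normalization.isAdicComplete hdim
  have hres' := Normalization.residueField_surjective (k := k) (R := R) hres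
  obtain ⟨π₀, hπ₀⟩ := IsDiscreteValuationRing.exists_irreducible (Normalization R)
  obtain ⟨t₀, -⟩ := exists_powerSeries_algEquiv hres' hπ₀
  obtain ⟨n, a, ha⟩ := exists_isHerzogKunzSequence t₀ hC0 hm hres
  have hmem : ∀ i, a i ∈ valueSet t₀ (maximalIdeal R) := fun i ↦
    (ha.range_eq.le (Set.mem_range_self i)).1
  obtain ⟨f, hfm, hf⟩ := hmem 0
  have ha0 : a 0 ≠ 0 := by
    have := tVal_ne_zero_of_mem_maximalIdeal t₀ hfm
    rw [hf] at this
    exact_mod_cast this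
  obtain ⟨π, hπ, hπa⟩ := exists_irreducible_pow_eq hres' t₀ ha0 hf
  obtain ⟨t, ht⟩ := exists_powerSeries_algEquiv hres' hπ
  have hord : ∀ m : ℕ, (t.symm (t PowerSeries.X ^ m)).order = m := fun m ↦ by
    rw [← map_pow, AlgEquiv.symm_apply_apply, PowerSeries.order_X_pow]
  obtain ⟨c, hcC, p, hp, hcp⟩ := exists_mem_conductorIdeal_tVal_mem t hm hC
  -- Values do not depend on the parameter, so the sequence survives the change from `t₀` to `t`.
  have ha' : IsHerzogKunzSequence t a := ha.congr
  obtain ⟨j, rfl⟩ := ha'.range_eq.ge hp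
  obtain ⟨g, -, hg⟩ := exists_algebraMap_eq_of_mem_conductorIdeal t hcC
    (y := t PowerSeries.X ^ a (Fin.last n)) (by
      rw [hcp, hord]
      exact_mod_cast ha.strictMono.monotone (Fin.le_last j))
  -- Treating both ends in one condition also covers `n = 0`, where they coincide.
  have hx : ∀ i, ∃ y : R, tVal t y = a i ∧
      (i = 0 ∨ i = Fin.last n → algebraMap R (Normalization R) y = t PowerSeries.X ^ a i) := by
    intro i
    by_cases hi : i = 0 ∨ i = Fin.last n
    · obtain ⟨y, hy⟩ : ∃ y : R, algebraMap R (Normalization R) y = t PowerSeries.X ^ a i := by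
        rcases hi with rfl | rfl
        · exact ⟨f, by rw [ht, hπa]⟩
        · exact ⟨g, hg⟩
      exact ⟨y, by rw [tVal, hy, hord], fun _ ↦ hy⟩
    · obtain ⟨y, -, hy⟩ := hmem i
      exact ⟨y, by rw [tVal_eq_tVal t t₀, hy], fun h ↦ absurd h hi⟩
  choose x hxa hxp using hx
  have hxm : ∀ i, x i ∈ maximalIdeal R := fun i ↦
    mem_maximalIdeal_of_tVal_ne_zero t (by
      have := ha.strictMono.monotone (Fin.zero_le i)
      rw [hxa]
      exact_mod_cast (show a i ≠ 0 by omega))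
  exact ⟨t, n, a, x, ha', hxa, isPowerSeriesGenerated_of_span_eq_maximalIdeal hres
    (span_range_eq_maximalIdeal t hC0 hm hxm hxa ha'.range_eq.ge),
    hxp 0 (Or.inl rfl), hxp _ (Or.inr rfl)⟩

end HerzogKunz

/-! ### A test module with a twisted action. -/

section WedgeModule

variable {k R K : Type*} [CommRing k] [CommRing R] [Algebra k R] [CommRing K] [Algebra R K]
  [Algebra k K]

/-- The `R`-module `K² ⊕ K` in which `r ∈ R` acts by `r (v, w) = (r v, r w + (D₁ r, D₂ r) ∧ v)`. -/
@[nolint unusedArguments]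
def WedgeModule (_D₁ _D₂ : Derivation k R K) : Type _ := K × K × K

namespace WedgeModule

variable (D₁ D₂ : Derivation k R K)

instance : AddCommGroup (WedgeModule D₁ D₂) := inferInstanceAs (AddCommGroup (K × K × K))

variable {D₁ D₂} in
@[ext]
theorem ext {x y : WedgeModule D₁ D₂} (h₁ : x.1 = y.1) (h₂ : x.2.1 = y.2.1)
    (h₃ : x.2.2 = y.2.2) : x = y :=
  Prod.ext h₁ (Prod.ext h₂ h₃)

/-- The element of `WedgeModule D₁ D₂` with given components. -/
def mk (a b c : K) : WedgeModule D₁ D₂ := (a, b, c)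

@[simp] theorem mk_fst (a b c : K) : (mk D₁ D₂ a b c).1 = a := rfl

@[simp] theorem mk_snd_fst (a b c : K) : (mk D₁ D₂ a b c).2.1 = b := rfl

@[simp] theorem mk_snd_snd (a b c : K) : (mk D₁ D₂ a b c).2.2 = c := rfl

@[simp] theorem add_fst (x y : WedgeModule D₁ D₂) : (x + y).1 = x.1 + y.1 := rfl

@[simp] theorem add_snd_fst (x y : WedgeModule D₁ D₂) : (x + y).2.1 = x.2.1 + y.2.1 := rfl

@[simp] theorem add_snd_snd (x y : WedgeModule D₁ D₂) : (x + y).2.2 = x.2.2 + y.2.2 := rfl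

@[simp] theorem zero_fst : (0 : WedgeModule D₁ D₂).1 = 0 := rfl

@[simp] theorem zero_snd_fst : (0 : WedgeModule D₁ D₂).2.1 = 0 := rfl

@[simp] theorem zero_snd_snd : (0 : WedgeModule D₁ D₂).2.2 = 0 := rfl

theorem sub_snd_snd (x y : WedgeModule D₁ D₂) : (x - y).2.2 = x.2.2 - y.2.2 := rfl

instance : SMul R (WedgeModule D₁ D₂) where
  smul r x := (algebraMap R K r * x.1, algebraMap R K r * x.2.1,
    algebraMap R K r * x.2.2 + (D₁ r * x.2.1 - D₂ r * x.1))

@[simp] theorem smul_fst (r : R) (x : WedgeModule D₁ D₂) :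
    (r • x).1 = algebraMap R K r * x.1 := rfl

@[simp] theorem smul_snd_fst (r : R) (x : WedgeModule D₁ D₂) :
    (r • x).2.1 = algebraMap R K r * x.2.1 := rfl

@[simp] theorem smul_snd_snd (r : R) (x : WedgeModule D₁ D₂) :
    (r • x).2.2 = algebraMap R K r * x.2.2 + (D₁ r * x.2.1 - D₂ r * x.1) := rfl

instance : Module R (WedgeModule D₁ D₂) where
  one_smul x := by ext <;> simp
  mul_smul r s x := by
    ext
    · simp [mul_assoc]
    · simp [mul_assoc]
    · simp [Algebra.smul_def]; ring
  smul_zero r := by ext <;> simp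
  smul_add r x y := by
    ext
    · simp [mul_add]
    · simp [mul_add]
    · simp; ring
  add_smul r s x := by
    ext
    · simp [add_mul]
    · simp [add_mul]
    · simp; ring
  zero_smul x := by ext <;> simp

instance : Module k (WedgeModule D₁ D₂) := Module.compHom _ (algebraMap k R)

instance : IsScalarTower k R (WedgeModule D₁ D₂) :=
  IsScalarTower.of_algebraMap_smul fun _ _ ↦ rfl

theorem finite (hK : Function.Surjective (algebraMap R K)) :
    Module.Finite R (WedgeModule D₁ D₂) := by
  let e : Fin 3 → WedgeModule D₁ D₂ := 
    ![mk D₁ D₂ 1 0 0, mk D₁ D₂ 0 1 0, mk D₁ D₂ 0 0 1]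
  refine Module.Finite.of_surjective (Fintype.linearCombination R e) fun x ↦ ?_
  obtain ⟨a, ha⟩ := hK x.1
  obtain ⟨b, hb⟩ := hK x.2.1
  -- The correction cancels the terms `-D₂ a` and `D₁ b` that the twist contributes.
  obtain ⟨c, hc⟩ := hK (x.2.2 + D₂ a - D₁ b)
  refine ⟨![a, b, c], ?_⟩
  rw [Fintype.linearCombination_apply, Fin.sum_univ_three]
  ext
  · simp [e, ha]
  · simp [e, hb]
  · simp [e, hc]

variable [IsScalarTower k R K]

/-- The `k`-linear map `r ↦ (D₁ r, D₂ r, 0)`. -/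
def derivationLinearMap : R →ₗ[k] WedgeModule D₁ D₂ where
  toFun r := mk D₁ D₂ (D₁ r) (D₂ r) 0
  map_add' r s := by ext <;> simp
  map_smul' c r := by
    rw [RingHom.id_apply, ← algebraMap_smul R c (mk D₁ D₂ (D₁ r) (D₂ r) 0)]
    ext <;> simp [Algebra.smul_def, ← IsScalarTower.algebraMap_apply, -algebraMap_smul]

theorem derivationLinearMap_apply (r : R) :
    derivationLinearMap D₁ D₂ r = mk D₁ D₂ (D₁ r) (D₂ r) 0 := rfl

/-- The derivation `r ↦ (D₁ r, D₂ r, 0)`. -/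
def derivation : Derivation k R (WedgeModule D₁ D₂) :=
  Derivation.mk' (derivationLinearMap D₁ D₂) fun r s ↦ by
    simp only [derivationLinearMap_apply]
    ext
    · simp [Algebra.smul_def]
    · simp [Algebra.smul_def]
    -- The cross terms `D₁ r * D₂ s - D₂ r * D₁ s` are antisymmetric in `r, s` and cancel.
    · simp
      ring

@[simp] theorem derivation_fst (r : R) : (derivation D₁ D₂ r).1 = D₁ r := rfl

@[simp] theorem derivation_snd_fst (r : R) : (derivation D₁ D₂ r).2.1 = D₂ r := rfl

@[simp] theorem derivation_snd_snd (r : R) : (derivation D₁ D₂ r).2.2 = 0 := rfl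

end WedgeModule

end WedgeModule

/-! ### Nonvanishing and torsion of the differential form. -/

section Torsion

variable {k : Type u} {R : Type v} [Field k] [CommRing R] [IsLocalRing R] [Algebra k R]

/-- Every linear map from the maximal ideal to the residue field extends to a derivation which
vanishes on the coefficient field. -/
theorem exists_derivation_residueField
    (hres : Function.Bijective (algebraMap k (ResidueField R)))
    (l : maximalIdeal R →ₗ[R] ResidueField R) :
    ∃ D : Derivation k R (ResidueField R), ∀ x : maximalIdeal R, D x = l x := by
  let e := RingEquiv.ofBijective _ hres
  have he : ∀ r : R, algebraMap k (ResidueField R) (e.symm (residue R r)) = residue R r :=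
    fun r ↦ e.apply_symm_apply _
  -- `p` projects onto the coefficient field, and the derivation is `r ↦ l (r - p r)`.
  let p : R → R := fun r ↦ algebraMap k R (e.symm (residue R r))
  have hp : ∀ r, residue R (p r) = residue R r := he
  have hmem : ∀ r : R, r - p r ∈ maximalIdeal R := fun r ↦
    (residue_eq_zero_iff _).1 (by rw [map_sub, hp, sub_self])
  have hpk : ∀ c : k, p (algebraMap k R c) = algebraMap k R c := fun c ↦
    congrArg _ (e.symm_apply_apply c)
  have hpadd : ∀ r s, p (r + s) = p r + p s := by simp [p]
  have hpmul : ∀ r s, p (r * s) = p r * p s := by simp [p]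
  let L : R →ₗ[k] ResidueField R :=
    { toFun := fun r ↦ l ⟨r - p r, hmem r⟩
      map_add' := fun r s ↦ by
        rw [← map_add]
        refine congrArg l (Subtype.ext ?_)
        simp only [hpadd, AddMemClass.mk_add_mk]
        ring
      map_smul' := fun c r ↦ by
        rw [RingHom.id_apply, ← algebraMap_smul R c (_ : ResidueField R), ← map_smul]
        refine congrArg l (Subtype.ext ?_)
        simp only [Algebra.smul_def, hpmul, hpk, SetLike.mk_smul_mk]
        simp only [Algebra.algebraMap_self, RingHom.id_apply]
        ring }
  have hsm : ∀ (r : R) (y : ResidueField R), p r • y = r • y := fun r y ↦ by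
    rw [Algebra.smul_def, Algebra.smul_def]
    exact congrArg (· * y) (hp r)
  refine ⟨Derivation.mk' L fun r s ↦ ?_, fun x ↦ ?_⟩
  -- Leibniz follows from `r s - p r p s = r (s - p s) + p s (r - p r)`, as `s` and `p s` act
  -- equally on the residue field.
  · change l _ = r • l _ + s • l _
    rw [← hsm s, ← map_smul, ← map_smul, ← map_add]
    refine congrArg l (Subtype.ext ?_)
    simp only [hpmul, SetLike.mk_smul_mk, smul_eq_mul, AddMemClass.mk_add_mk]
    ring
  · refine congrArg l (Subtype.ext ?_)
    have hx : residue R (x : R) = 0 := (residue_eq_zero_iff _).2 x.2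
    simp [p, hx]

theorem IsUniversallyFinite.smul_sub_smul_ne_zero [CharZero k]
    (hres : Function.Bijective (algebraMap k (ResidueField R)))
    {Ω : Type w} [AddCommGroup Ω] [Module R Ω] [Module k Ω] [IsScalarTower k R Ω]
    {d : Derivation k R Ω} (hd : IsUniversallyFinite d) {x : Fin 2 → maximalIdeal R}
    (hx : LinearIndependent (ResidueField R)
      fun i ↦ ((maximalIdeal R).toCotangent (x i) : CotangentSpace R))
    {a b : ℕ} (hab : a + b ≠ 0) :
    ((a : R) * x 1) • d (x 0) - ((b : R) * x 0) • d (x 1) ≠ 0 := by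
  classical
  -- The coordinates of `g` are functionals on the cotangent space dual to the classes of `x 0` and
  -- `x 1`.
  obtain ⟨g, hg⟩ := LinearMap.exists_leftInverse_of_injective _
    (LinearMap.ker_eq_bot.2 hx)
  have hgx : ∀ i j, g ((maximalIdeal R).toCotangent (x j)) i = if j = i then 1 else 0 := by
    intro i j
    have h := LinearMap.congr_fun hg (Finsupp.single j 1)
    rw [LinearMap.comp_apply, Finsupp.linearCombination_single, one_smul] at h
    rw [h, LinearMap.id_apply, Finsupp.single_apply]
  have hD : ∀ i : Fin 2, ∃ D : Derivation k R (ResidueField R), ∀ j : Fin 2,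
      D (x j) = if j = i then 1 else 0 := by
    intro i
    obtain ⟨D, hD⟩ := exists_derivation_residueField hres
      (((Finsupp.lapply i ∘ₗ g).restrictScalars R) ∘ₗ (maximalIdeal R).toCotangent)
    exact ⟨D, fun j ↦ (hD _).trans (hgx i j)⟩
  obtain ⟨D₁, hD₁⟩ := hD 0
  obtain ⟨D₂, hD₂⟩ := hD 1
  have := WedgeModule.finite D₁ D₂ residue_surjective
  obtain ⟨f, hf, -⟩ := hd.2 (WedgeModule D₁ D₂) (WedgeModule.derivation D₁ D₂)
  intro h0
  have h1 := congrArg (fun ω ↦ (f ω).2.2) h0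
  have hxr : ∀ i, algebraMap R (ResidueField R) (x i) = 0 := fun i ↦
    (residue_eq_zero_iff _).2 (x i).2
  simp only [map_sub, map_smul, hf, map_zero, WedgeModule.sub_snd_snd, WedgeModule.smul_snd_snd,
    WedgeModule.derivation_fst, WedgeModule.derivation_snd_fst, WedgeModule.derivation_snd_snd,
    Derivation.leibniz, Derivation.map_natCast, hD₁, hD₂, Algebra.smul_def, map_natCast, hxr,
    WedgeModule.zero_snd_snd] at h1
  -- `h1` says that the last coordinate `-(a + b)` of the image vanishes.
  have h2 : ((a + b : ℕ) : ResidueField R) = 0 := by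
    push_cast
    simp at h1
    linear_combination -h1
  rw [← map_natCast (algebraMap k (ResidueField R)), map_eq_zero_iff _ hres.1] at h2
  exact hab (Nat.cast_eq_zero.1 h2)

omit [IsLocalRing R] in
theorem Derivation.smul_sub_smul_mem_torsion [IsDomain R] {Ω : Type*} [AddCommGroup Ω]
    [Module R Ω] [Module k Ω] (d : Derivation k R Ω) {x y : R} (hx : x ≠ 0) {a b : ℕ} (ha : a ≠ 0)
    (hb : b ≠ 0) (hxy : x ^ b = y ^ a) :
    ((b : R) * y) • d x - ((a : R) * x) • d y ∈ Submodule.torsion R Ω := by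
  rw [Submodule.mem_torsion_iff]
  refine ⟨⟨x ^ b, mem_nonZeroDivisors_of_ne_zero (pow_ne_zero b hx)⟩, ?_⟩
  have h := congrArg d hxy
  rw [d.leibniz_pow, d.leibniz_pow] at h
  have hb' : x ^ b = x ^ (b - 1) * x := (pow_sub_one_mul hb x).symm
  have ha' : y ^ a = y ^ (a - 1) * y := (pow_sub_one_mul ha y).symm
  change x ^ b • _ = (0 : Ω)
  have h1 : x ^ b • ((b : R) * y) • d x = (x * y) • b • x ^ (b - 1) • d x := by
    rw [← Nat.cast_smul_eq_nsmul R b, smul_smul, smul_smul, smul_smul, hb']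
    congr 1
    ring
  have h2 : x ^ b • ((a : R) * x) • d y = (x * y) • a • y ^ (a - 1) • d y := by
    rw [← Nat.cast_smul_eq_nsmul R a, smul_smul, smul_smul, smul_smul, hxy, ha']
    congr 1
    ring
  rw [smul_sub, h1, h2, h, sub_self]

end Torsion

theorem mainTheorem7 {k : Type u} {R : Type v} [Field k] [IsAlgClosed k] [CharZero k]
    [CommRing R] [IsDomain R] [IsLocalRing R] [IsNoetherianRing R]
    [IsAdicComplete (maximalIdeal R) R] [Algebra k R]
    (hdim : ringKrullDim R = 1)
    (hres : Function.Bijective (algebraMap k (ResidueField R)))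
    (hC : ¬ conductorIdeal R ≤ maximalIdeal R ^ 2) :
    (∃ (t : PowerSeries k ≃ₐ[k] Normalization R) (n : ℕ) (a : Fin (n + 1) → ℕ)
      (x : Fin (n + 1) → R), IsPureHerzogKunzParametrization t a x) ∧
    (∃ (Ω : Type v) (_ : AddCommGroup Ω) (_ : Module R Ω) (_ : Module k Ω)
      (_ : IsScalarTower k R Ω) (d : Derivation k R Ω), IsUniversallyFinite d) ∧
    (∀ (t : PowerSeries k ≃ₐ[k] Normalization R) (n : ℕ) (a : Fin (n + 1) → ℕ)
      (x : Fin (n + 1) → R), IsPureHerzogKunzParametrization t a x →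
      -- the embedding dimension `n + 1` is at least `2`, that is, `R` is not regular
      2 ≤ n + 1 →
      ∀ (Ω : Type w) [AddCommGroup Ω] [Module R Ω] [Module k Ω] [IsScalarTower k R Ω]
        (d : Derivation k R Ω), IsUniversallyFinite d →
        ((a (Fin.last n) : R) * x (Fin.last n)) • d (x 0)
            - ((a 0 : R) * x 0) • d (x (Fin.last n)) ∈ Submodule.torsion R Ω ∧
        ((a (Fin.last n) : R) * x (Fin.last n)) • d (x 0)
            - ((a 0 : R) * x 0) • d (x (Fin.last n)) ≠ 0) := by
  refine ⟨exists_isPureHerzogKunzParametrization hdim hres.2 hC,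
    exists_isUniversallyFinite hres.2, ?_⟩
  intro t n a x h hn Ω _ _ _ _ d hd
  have hmem : ∀ i, a i ∈ valueSet t (maximalIdeal R) \ valueSet t (maximalIdeal R ^ 2) :=
    fun i ↦ h.isHerzogKunzSequence.range_eq.le (Set.mem_range_self i)
  have ha : ∀ i, a i ≠ 0 := by
    intro i
    obtain ⟨f, hfm, hf⟩ := (hmem i).1
    have := tVal_ne_zero_of_mem_maximalIdeal t hfm
    rw [hf] at this
    exact_mod_cast this
  have hx : ∀ i, x i ∈ maximalIdeal R := fun i ↦
    mem_maximalIdeal_of_tVal_ne_zero t (by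
      rw [h.val_eq]
      exact_mod_cast ha i)
  have hx0 : x 0 ≠ 0 := by
    rw [Ne, ← tVal_eq_top t, h.val_eq]
    exact ENat.natCast_ne_top _
  refine ⟨d.smul_sub_smul_mem_torsion hx0 (ha 0) (ha (Fin.last n)) ?_, ?_⟩
  · refine Normalization.algebraMap_injective ?_
    -- Both sides are `t` to the power `a 0 * a (Fin.last n)`.
    rw [map_pow, map_pow, h.first_eq, h.last_eq, ← pow_mul, ← pow_mul, mul_comm]
  · have hli := linearIndependent_toCotangent t hres.2 hx
      h.isHerzogKunzSequence.strictMono.injective h.val_eq fun i ↦ (hmem i).2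
    have hinj : Function.Injective ![(0 : Fin (n + 1)), Fin.last n] := by
      intro i j hij
      have h0 : (0 : Fin (n + 1)) ≠ Fin.last n := by
        rw [Ne, Fin.ext_iff, Fin.val_zero, Fin.val_last]
        omega
      fin_cases i <;> fin_cases j <;> simp_all
    exact hd.smul_sub_smul_ne_zero hres
      (x := fun i ↦ ⟨x (![(0 : Fin (n + 1)), Fin.last n] i), hx _⟩)
      (hli.comp _ hinj) (a := a (Fin.last n)) (b := a 0) (by have := ha 0; omega)
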